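/- \textbf{Setting.} Let $d\ge 2$, $Q=[0,1]^d$, $Q_0\subset Q$, $\epsilon>0$, and let $Q_1^\epsilon=\{x: x/\epsilon\in Q\setminus\overline{Q_0}\}+\epsilon\mathbb Z^d$. Let $\Omega\subset\mathbb R^d$ be a bounded domain, $\Omega_1\subset\Omega$, and suppose that $\Omega^\epsilon=(\Omega_1\cap Q_1^\epsilon)\cup(\Omega\setminus\Omega_1)$ is open. Let $\mathcal T_H$ be a finite partition of $\Omega$ into open connected elements, with mesh size $H=\max_{K\in\mathcal T_H}\operatorname{diam}K$ and vertices $O_1,\dots,O_N$, and let $\omega_i$ be the union of the elements whose closures contain $O_i$ (understood as an open set: the interior of $\Omega\cap\bigcup\{\overline K: K\in\mathcal T_H,\ O_i\in\overline K\}$). Put $D_i=\Omega^\epsilon\cap\omega_i$ and $\Gamma_i=\partial\omega_i\setminus\partial Q_1^\epsilon$, and let $H^1_{\Gamma_i}(D_i)$ be the space of all $v\in H^1(D_i;\mathbb C)$ that vanish on $\Gamma_i$, that is, the closure in $H^1(D_i;\mathbb C)$ of the functions that vanish in a neighbourhood of $\Gamma_i$. Let $k>0$, $\|v\|_{V(D_i)}^2=\|\nabla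 v\|_{L^2(D_i)}^2+k^2\|v\|_{L^2(D_i)}^2$, and $$a_i(v_1,v_2)=\int_{D_i}\nabla v_1\cdot\nabla\overline{v_2}\,dx-k^2\int_{D_i}v_1\overline{v_2}\,dx,$$ $$C_{\mathrm{poin}}(\omega_i)=H^{-2}\sup_{0\ne w\in H^1_{\Gamma_i}(D_i)}\frac{\int_{D_i}|w|^2\,dx}{\int_{D_i}|\nabla w|^2\,dx}\in[0,\infty].$$ Suppose that the Scale Resolution Assumption $\max_{j}C_{\mathrm{poin}}(\omega_j)^{1/2}\,Hk<1$ holds, and let $C_e=\bigl(1-\max_{j}C_{\mathrm{poin}}(\omega_j)(Hk)^2\bigr)^{-1}$. For $g\in L^2(\Omega^\epsilon;\mathbb C)$ let $m_i(g)$ denote the average over $\omega_i$ of $g$ extended by zero outside $\Omega^\epsilon$. \textbf{Lemma.} Let $i\in\{1,\dots,N\}$. (1) For every $f\in L^2(\Omega^\epsilon;\mathbb C)$ there is exactly one weak solution $u^{i,\mathrm I}$ of $$-(\Delta+k^2)u^{i,\mathrm I}=f-m_i(f)\ \text{in } \Omega^\epsilon\cap\omega_i,\qquad \frac{\partial u^{i,\mathrm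 I}}{\partial n}=0\ \text{on }\partial Q_1^\epsilon\cap\omega_i,\qquad u^{i,\mathrm I}=0\ \text{on }\partial\omega_i\setminus\partial Q_1^\epsilon,$$ that is, exactly one $u^{i,\mathrm I}\in H^1_{\Gamma_i}(D_i)$ with $a_i(u^{i,\mathrm I},v)=\int_{D_i}(f-m_i(f))\,\overline v\,dx$ for all $v\in H^1_{\Gamma_i}(D_i)$, and it satisfies $$\|u^{i,\mathrm I}\|_{V(\Omega^\epsilon\cap\omega_i)}\le 2\,C_e\,C_{\mathrm{poin}}(\omega_i)^{1/2}\,H\,\|f\|_{L^2(\Omega^\epsilon\cap\omega_i)}.$$ (2) For every $w\in L^2(\Omega^\epsilon;\mathbb C)$ there is exactly one $z^{i,\mathrm I}\in H^1_{\Gamma_i}(D_i)$ with $a_i(v,z^{i,\mathrm I})=\int_{D_i}v\,\overline{(w-m_i(w))}\,dx$ for all $v\in H^1_{\Gamma_i}(D_i)$, and it satisfies $$\|z^{i,\mathrm I}\|_{V(\Omega^\epsilon\cap\omega_i)}\le 2\,C_e\,C_{\mathrm{poin}}(\omega_i)^{1/2}\,H\,\|w\|_{L^2(\Omega^\epsilon\cap\omega_i)}.$$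 Both parts also hold when $m_i(g)$ denotes instead the average of $g$ over $\Omega^\epsilon\cap\omega_i$. -/

import Mathlib

open MeasureTheory
open scoped ContDiff ENNReal

noncomputable section

namespace PerforatedHelmholtz

/-- Euclidean space `ℝ^d`. -/
abbrev Pt (d : ℕ) := EuclideanSpace ℝ (Fin d)

/-! ### Complex-valued Sobolev spaces -/

/-- `g` is a weak gradient of `u` on the open set `D`: for every real test function
`φ ∈ C_c^∞(D)` and every `j`, `∫_D u ∂_j φ = - ∫_D g_j φ`. -/
def IsWeakGradient {d : ℕ} (D : Set (Pt d)) (u : Pt d → ℂ)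
    (g : Pt d → EuclideanSpace ℂ (Fin d)) : Prop :=
  ∀ φ : Pt d → ℝ, ContDiff ℝ ∞ φ → HasCompactSupport φ → tsupport φ ⊆ D →
    ∀ j : Fin d,
      ∫ x in D, (fderiv ℝ φ x (EuclideanSpace.single j 1)) • u x
        = - ∫ x in D, φ x • (g x) j

/-- Pairs `(u, g)` in `L²(D; ℂ) × L²(D; ℂ^d)`, with the Hilbert norm
`(‖u‖² + ‖g‖²)^{1/2}`. -/
abbrev L2Pair {d : ℕ} (D : Set (Pt d)) :=
  WithLp 2 (Lp ℂ 2 (volume.restrict D) × Lp (EuclideanSpace ℂ (Fin d)) 2 (volume.restrict D))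

lemma integrable_test_smul {d : ℕ} {D : Set (Pt d)} {F : Type*} [NormedAddCommGroup F]
    [NormedSpace ℝ F] {ψ : Pt d → ℝ} (hψ : Continuous ψ) (hc : HasCompactSupport ψ)
    {u : Pt d → F} (hu : MemLp u 2 (volume.restrict D)) :
    Integrable (fun x => ψ x • u x) (volume.restrict D) := by
  have h : MemLp ψ 2 (volume.restrict D) := (hψ.memLp_of_hasCompactSupport hc).restrict D
  have h2 : MemLp (ψ • u) 1 (volume.restrict D) := hu.smul h
  exact memLp_one_iff_integrable.1 h2

lemma memLp_coord {d : ℕ} {D : Set (Pt d)} {g : Pt d → EuclideanSpace ℂ (Fin d)}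
    (hg : MemLp g 2 (volume.restrict D)) (j : Fin d) :
    MemLp (fun x => (g x) j) 2 (volume.restrict D) :=
  (EuclideanSpace.proj j : EuclideanSpace ℂ (Fin d) →L[ℂ] ℂ).comp_memLp' hg

lemma integrable_dtest_smul {d : ℕ} {D : Set (Pt d)} {φ : Pt d → ℝ} (hφ : ContDiff ℝ ∞ φ)
    (hc : HasCompactSupport φ) (j : Fin d) {u : Pt d → ℂ} (hu : MemLp u 2 (volume.restrict D)) :
    Integrable (fun x => (fderiv ℝ φ x (EuclideanSpace.single j 1)) • u x)
      (volume.restrict D) :=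
  integrable_test_smul (ψ := fun x => fderiv ℝ φ x (EuclideanSpace.single j 1))
    ((hφ.continuous_fderiv (by simp)).clm_apply continuous_const)
    (hc.fderiv_apply (𝕜 := ℝ) (EuclideanSpace.single j 1)) hu

/-- The Sobolev space `H¹(D; ℂ)` of an open set `D`: an element is an `L²` function together with
its weak gradient. The norm is `(‖u‖² + ‖∇u‖²)^{1/2}`. -/
def H1 {d : ℕ} (D : Set (Pt d)) : Submodule ℂ (L2Pair D) where
  carrier := {p | IsWeakGradient D p.fst p.snd}
  zero_mem' := by
    intro φ _ _ _ j
    have h1 : ∫ x in D, (fderiv ℝ φ x (EuclideanSpace.single j 1)) •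
        ((0 : Lp ℂ 2 (volume.restrict D)) : Pt d → ℂ) x = 0 := by
      refine integral_eq_zero_of_ae ?_
      filter_upwards [Lp.coeFn_zero ℂ 2 (volume.restrict D)] with x hx
      rw [hx]
      simp
    have h2 : ∫ x in D, φ x • (((0 : Lp (EuclideanSpace ℂ (Fin d)) 2 (volume.restrict D)) :
        Pt d → EuclideanSpace ℂ (Fin d)) x) j = 0 := by
      refine integral_eq_zero_of_ae ?_
      filter_upwards [Lp.coeFn_zero (EuclideanSpace ℂ (Fin d)) 2 (volume.restrict D)] with x hx
      rw [hx]
      simp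
    simp only [WithLp.zero_fst, WithLp.zero_snd]
    rw [h1, h2, neg_zero]
  add_mem' := by
    intro p q hp hq φ hφ hc hs j
    have e1 : ∫ x in D, (fderiv ℝ φ x (EuclideanSpace.single j 1)) • (p + q).fst x
        = (∫ x in D, (fderiv ℝ φ x (EuclideanSpace.single j 1)) • p.fst x)
          + ∫ x in D, (fderiv ℝ φ x (EuclideanSpace.single j 1)) • q.fst x := by
      rw [← integral_add (integrable_dtest_smul hφ hc j (Lp.memLp p.fst))
        (integrable_dtest_smul hφ hc j (Lp.memLp q.fst))]
      refine integral_congr_ae ?_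
      filter_upwards [Lp.coeFn_add p.fst q.fst] with x hx
      simp only [WithLp.add_fst, hx, Pi.add_apply, smul_add]
    have e2 : ∫ x in D, φ x • ((p + q).snd x) j
        = (∫ x in D, φ x • (p.snd x) j) + ∫ x in D, φ x • (q.snd x) j := by
      rw [← integral_add
        (integrable_test_smul hφ.continuous hc (memLp_coord (Lp.memLp p.snd) j))
        (integrable_test_smul hφ.continuous hc (memLp_coord (Lp.memLp q.snd) j))]
      refine integral_congr_ae ?_
      filter_upwards [Lp.coeFn_add p.snd q.snd] with x hx
      simp only [WithLp.add_snd, hx, Pi.add_apply, PiLp.add_apply, smul_add]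
    rw [e1, e2, hp φ hφ hc hs j, hq φ hφ hc hs j, neg_add]
  smul_mem' := by
    intro c p hp φ hφ hc hs j
    have e1 : ∫ x in D, (fderiv ℝ φ x (EuclideanSpace.single j 1)) • (c • p).fst x
        = c • ∫ x in D, (fderiv ℝ φ x (EuclideanSpace.single j 1)) • p.fst x := by
      rw [← integral_smul]
      refine integral_congr_ae ?_
      filter_upwards [Lp.coeFn_smul c p.fst] with x hx
      simp only [WithLp.smul_fst, hx, Pi.smul_apply]
      rw [smul_comm]
    have e2 : ∫ x in D, φ x • ((c • p).snd x) j = c • ∫ x in D, φ x • (p.snd x) j := by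
      rw [← integral_smul]
      refine integral_congr_ae ?_
      filter_upwards [Lp.coeFn_smul c p.snd] with x hx
      simp only [WithLp.smul_snd, hx, Pi.smul_apply, PiLp.smul_apply]
      rw [smul_comm]
    rw [e1, e2, hp φ hφ hc hs j, smul_neg]

/-- The `L²` function underlying `u ∈ H¹(D)`. -/
abbrev fn {d : ℕ} {D : Set (Pt d)} (u : H1 D) : Lp ℂ 2 (volume.restrict D) := u.1.fst

/-- The weak gradient of `u ∈ H¹(D)`. -/
abbrev grad {d : ℕ} {D : Set (Pt d)} (u : H1 D) :
    Lp (EuclideanSpace ℂ (Fin d)) 2 (volume.restrict D) := u.1.snd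

/-- The functions in `H¹(D)` that vanish (a.e.) in a neighbourhood of `Γ`. -/
def vanishingNear {d : ℕ} (D Γ : Set (Pt d)) : Submodule ℂ (H1 D) where
  carrier := {u | ∃ U : Set (Pt d), IsOpen U ∧ Γ ⊆ U ∧
    ∀ᵐ x ∂(volume.restrict D), x ∈ U → fn u x = 0}
  zero_mem' := by
    refine ⟨Set.univ, isOpen_univ, Set.subset_univ _, ?_⟩
    filter_upwards [Lp.coeFn_zero ℂ 2 (volume.restrict D)] with x hx _
    exact hx
  add_mem' := by
    rintro u v ⟨U, hU, hΓU, hu⟩ ⟨W, hW, hΓW, hv⟩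
    refine ⟨U ∩ W, hU.inter hW, Set.subset_inter hΓU hΓW, ?_⟩
    filter_upwards [hu, hv, Lp.coeFn_add (fn u) (fn v)] with x h1 h2 h3 hx
    have h4 : fn (u + v) x = fn u x + fn v x := by simpa [fn] using h3
    rw [h4, h1 hx.1, h2 hx.2, add_zero]
  smul_mem' := by
    rintro c u ⟨U, hU, hΓU, hu⟩
    refine ⟨U, hU, hΓU, ?_⟩
    filter_upwards [hu, Lp.coeFn_smul c (fn u)] with x h1 h3 hx
    have h4 : fn (c • u) x = c • fn u x := by simpa [fn] using h3
    rw [h4, h1 hx, smul_zero]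

/-- `H¹_Γ(D)`: the functions in `H¹(D)` with zero boundary values on `Γ`, i.e. the closure in
`H¹(D)` of the functions vanishing near `Γ`. For a Lipschitz domain `D` and a relatively open part
`Γ` of its boundary these are exactly the functions with zero trace on `Γ`. Nothing is imposed on
the rest of the boundary. -/
def H1Zero {d : ℕ} (D Γ : Set (Pt d)) : Submodule ℂ (H1 D) :=
  (vanishingNear D Γ).topologicalClosure

/-! ### Geometry -/

/-- The closed reference cell `Q = [0,1]^d`. -/
def unitCell (d : ℕ) : Set (Pt d) := {x | ∀ j, x j ∈ Set.Icc (0 : ℝ) 1}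

/-- `Q₁^ε`: the set `{x : x / ε ∈ Q \ closure Q₀}`, repeated with period `ε` in every coordinate
direction. -/
def periodicCells {d : ℕ} (Q₀ : Set (Pt d)) (ε : ℝ) : Set (Pt d) :=
  {x | ∃ z : Fin d → ℤ,
    ε⁻¹ • (x - ε • WithLp.toLp 2 (fun j => (z j : ℝ))) ∈ unitCell d \ closure Q₀}

/-- `Ω^ε = (Ω₁ ∩ Q₁^ε) ∪ (Ω \ Ω₁)`. -/
def perforate {d : ℕ} (Q₀ : Set (Pt d)) (ε : ℝ) (Ω Ω₁ : Set (Pt d)) : Set (Pt d) :=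
  (Ω₁ ∩ periodicCells Q₀ ε) ∪ (Ω \ Ω₁)

/-- The data of a perforated domain in `ℝ^d`. Only what is needed for `Ω^ε` to be a bounded open
set is required; no regularity of `∂Ω`, `∂Ω₁` or `∂Q₀` is used. -/
structure Geometry (d : ℕ) where
  /-- the hole in the reference cell -/
  Q₀ : Set (Pt d)
  /-- the period -/
  ε : ℝ
  /-- the unperforated domain -/
  Ω : Set (Pt d)
  /-- the part of `Ω` that is perforated -/
  Ω₁ : Set (Pt d)
  hole_subset : Q₀ ⊆ unitCell d
  ε_pos : 0 < ε
  isOpen : IsOpen Ω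
  isConnected : IsConnected Ω
  isBounded : Bornology.IsBounded Ω
  sub : Ω₁ ⊆ Ω
  isOpen_perforated : IsOpen (perforate Q₀ ε Ω Ω₁)

/-- The computational domain `Ω^ε`. -/
def Geometry.dom {d : ℕ} (G : Geometry d) : Set (Pt d) := perforate G.Q₀ G.ε G.Ω G.Ω₁

/-- The interfaces `∂Q₁^ε`. -/
def Geometry.interface {d : ℕ} (G : Geometry d) : Set (Pt d) :=
  frontier (periodicCells G.Q₀ G.ε)

/-- A coarse mesh of `Ω`: finitely many pairwise disjoint open connected elements whose closures
cover `Ω`, each with a finite set of vertices on its boundary; the nodes `O_1, …, O_N` are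
the vertices of the elements, listed without repetition. The elements may be simplices,
quadrilaterals, hexahedra, or more general. -/
structure CoarseMesh {d : ℕ} (Ω : Set (Pt d)) where
  /-- the number of elements -/
  M : ℕ
  /-- the (open) elements -/
  elem : Fin M → Set (Pt d)
  elem_open : ∀ j, IsOpen (elem j)
  elem_connected : ∀ j, IsConnected (elem j)
  elem_subset : ∀ j, elem j ⊆ Ω
  elem_disjoint : Pairwise fun j l => Disjoint (elem j) (elem l)
  cover : Ω ⊆ ⋃ j, closure (elem j)
  /-- the vertices of an element -/
  vert : Fin M → Finset (Pt d)
  vert_subset : ∀ j, (vert j : Set (Pt d)) ⊆ frontier (elem j)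
  /-- the number of nodes -/
  N : ℕ
  /-- the nodes -/
  node : Fin N → Pt d
  node_injective : Function.Injective node
  range_node : Set.range node = ⋃ j, (vert j : Set (Pt d))

variable {d : ℕ}

/-- The mesh size: the largest diameter of an element. -/
def CoarseMesh.size {Ω : Set (Pt d)} (T : CoarseMesh Ω) : ℝ := ⨆ j, Metric.diam (T.elem j)

/-- The coarse neighbourhood `ω_i` of the node `O_i`, the union of the elements whose closures
contain `O_i`, as an open set (that is, including the faces between these elements). -/
def CoarseMesh.nbhd {Ω : Set (Pt d)} (T : CoarseMesh Ω) (i : Fin T.N) : Set (Pt d) :=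
  interior (Ω ∩ ⋃ j ∈ {j | T.node i ∈ closure (T.elem j)}, closure (T.elem j))

/-- The local domain `Ω^ε ∩ ω_i`. -/
def locDom (G : Geometry d) (T : CoarseMesh G.Ω) (i : Fin T.N) : Set (Pt d) :=
  G.dom ∩ T.nbhd i

/-- The part `∂ω_i \ ∂Q₁^ε` of the boundary with Dirichlet data. -/
def dirichletPart (G : Geometry d) (T : CoarseMesh G.Ω) (i : Fin T.N) : Set (Pt d) :=
  frontier (T.nbhd i) \ G.interface

/-- The functions in `H¹(Ω^ε ∩ ω_i)` that vanish on `∂ω_i \ ∂Q₁^ε`. -/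
abbrev LocSpace (G : Geometry d) (T : CoarseMesh G.Ω) (i : Fin T.N) :
    Submodule ℂ (H1 (locDom G T i)) :=
  H1Zero (locDom G T i) (dirichletPart G T i)

/-! ### Constants -/

/-- The Poincaré constant `C_poin(ω_i) = H⁻² sup_w ∫ |w|² / ∫ |∇w|²`, with `w` ranging over the
functions in `H¹(Ω^ε ∩ ω_i)` that vanish on `∂ω_i \ ∂Q₁^ε`; a value in `[0, ∞]`
(in `ℝ≥0∞`, `0 / 0 = 0` and `a / 0 = ∞` for `a ≠ 0`). -/
def Cpoin (G : Geometry d) (T : CoarseMesh G.Ω) (i : Fin T.N) : ℝ≥0∞ :=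
  (⨆ w : LocSpace G T i, ‖fn w.1‖ₑ ^ 2 / ‖grad w.1‖ₑ ^ 2) / ENNReal.ofReal T.size ^ 2

/-- Scale Resolution Assumption: `max_i C_poin(ω_i)^{1/2} H k < 1`. -/
def ScaleResolution (G : Geometry d) (T : CoarseMesh G.Ω) (k : ℝ) : Prop :=
  (⨆ i, Cpoin G T i ^ (1 / 2 : ℝ)) * ENNReal.ofReal (T.size * k) < 1

/-- `C_e = (1 - max_i C_poin(ω_i) (H k)²)⁻¹`. -/
def Ce (G : Geometry d) (T : CoarseMesh G.Ω) (k : ℝ) : ℝ :=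
  (1 - (⨆ i, Cpoin G T i).toReal * (T.size * k) ^ 2)⁻¹

/-! ### The local problems -/

/-- The `k`-weighted norm of `V(D)`: `(‖∇v‖² + k² ‖v‖²)^{1/2}`. -/
def energyNorm {D : Set (Pt d)} (k : ℝ) (v : H1 D) : ℝ :=
  Real.sqrt (‖grad v‖ ^ 2 + k ^ 2 * ‖fn v‖ ^ 2)

/-- `∫_D ∇v₁ · conj ∇v₂ - k² ∫_D v₁ conj v₂`. Mathlib's inner product is conjugate linear in its
first argument. -/
def helmholtzForm {D : Set (Pt d)} (k : ℝ) (v₁ v₂ : H1 D) : ℂ :=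
  (∫ x in D, inner ℂ (grad v₂ x) (grad v₁ x))
    - (k : ℂ) ^ 2 * ∫ x in D, fn v₁ x * starRingEnd ℂ (fn v₂ x)

/-- The average over `A` of a function on `Ω^ε` extended by zero. -/
def meanOver (G : Geometry d) (A : Set (Pt d)) (f : Pt d → ℂ) : ℂ :=
  ⨍ x in A, G.dom.indicator f x

/-- `u` is the weak solution of `-(Δ + k²) u = f - m` in `Ω^ε ∩ ω_i`, `∂u/∂n = 0` on the
interfaces, `u = 0` on `∂ω_i \ ∂Q₁^ε`. -/
def IsLocalSolution (G : Geometry d) (T : CoarseMesh G.Ω) (i : Fin T.N) (k : ℝ)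
    (f : Pt d → ℂ) (m : ℂ) (u : LocSpace G T i) : Prop :=
  ∀ v : LocSpace G T i,
    helmholtzForm k u.1 v.1 = ∫ x in locDom G T i, (f x - m) * starRingEnd ℂ (fn v.1 x)

/-- `z` is the weak solution of the corresponding dual problem, in which the unknown is the second
argument of the sesquilinear form and of the `L²` inner product. -/
def IsDualLocalSolution (G : Geometry d) (T : CoarseMesh G.Ω) (i : Fin T.N) (k : ℝ)
    (w : Pt d → ℂ) (m : ℂ) (z : LocSpace G T i) : Prop :=
  ∀ v : LocSpace G T i,
    helmholtzForm k v.1 z.1 = ∫ x in locDom G T i, fn v.1 x * starRingEnd ℂ (w x - m)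

/-- The norm of `L²(D; ℂ)`. -/
def l2Norm (D : Set (Pt d)) (f : Pt d → ℂ) : ℝ := (eLpNorm f 2 (volume.restrict D)).toReal

end PerforatedHelmholtz

end

/-!
The local Helmholtz problem is coercive as soon as the resolution condition holds. For
`v ∈ H¹_Γ(D)` the definition of `Cpoin` gives `‖v‖² ≤ P ‖∇v‖²` with `P = C_poin H²`, so
`Re a(v, v) = ‖∇v‖² - k² ‖v‖² ≥ (1 - P k²) ‖∇v‖²`, and `P k² < 1` by assumption. The space
`H¹_Γ(D)` is complete, because a weak gradient is characterized by `L²` inner products with fixed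
functions (`isClosed_H1`), and the operator of the coercive form on it is invertible; this is
`existsUnique_of_poincare`.

For the estimate, testing with `u` itself gives `‖∇u‖ ≤ C_e √P ‖f - m‖`, and
`‖u‖_V² ≤ (1 + P k²) ‖∇u‖² ≤ 4 ‖∇u‖²`; this is `sqrt_energy_le_of_poincare`. Subtracting the mean is
an orthogonal projection in `L²(A)`, and `f` extended by zero has the same norm on `A` as on `D`,
so `‖f - m‖_{L²(D)} ≤ ‖f‖_{L²(D)}` for both choices of the set `A` over which the average is taken
(`l2Norm_sub_meanOver_le`).

The form is Hermitian, so the dual problem is the conjugate of the primal one and has the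
same solutions (`isDualLocalSolution_iff`).
-/

noncomputable section

namespace PerforatedHelmholtz

/-! ### Hermitian forms bounded below by a Poincaré inequality -/

section Abstract

variable {V E F : Type*} [NormedAddCommGroup V] [InnerProductSpace ℂ V]
  [NormedAddCommGroup E] [InnerProductSpace ℂ E]
  [NormedAddCommGroup F] [InnerProductSpace ℂ F]

/-- Lax–Milgram for the form `⟪G v, G u⟫ - k² ⟪J v, J u⟫`, where `G` plays the role of the gradient
and `J` that of the embedding into `L²`. The norm of `V` is assumed to be the graph norm, so that `G`
and `J` are bounded. -/
theorem existsUnique_of_poincare [CompleteSpace V] [CompleteSpace E] [CompleteSpace F]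
    (G : V →ₗ[ℂ] E) (J : V →ₗ[ℂ] F) {P k : ℝ} (hP : 0 ≤ P)
    (hnorm : ∀ v, ‖v‖ ^ 2 = ‖G v‖ ^ 2 + ‖J v‖ ^ 2) (hpoin : ∀ v, ‖J v‖ ^ 2 ≤ P * ‖G v‖ ^ 2)
    (hPk : P * k ^ 2 < 1) (g : F) :
    ∃! u, ∀ v, inner ℂ (G v) (G u) - (k : ℂ) ^ 2 * inner ℂ (J v) (J u) = inner ℂ (J v) g := by
  let G' : V →L[ℂ] E := G.mkContinuous 1 fun v => by
    rw [one_mul]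
    exact abs_le_of_sq_le_sq' (by linarith [hnorm v, sq_nonneg ‖J v‖]) (norm_nonneg v) |>.2
  let J' : V →L[ℂ] F := J.mkContinuous 1 fun v => by
    rw [one_mul]
    exact abs_le_of_sq_le_sq' (by linarith [hnorm v, sq_nonneg ‖G v‖]) (norm_nonneg v) |>.2
  let S : V →L[ℂ] V := G'.adjoint ∘L G' - ((k : ℂ) ^ 2) • (J'.adjoint ∘L J')
  have hS : ∀ u v, inner ℂ v (S u)
      = inner ℂ (G v) (G u) - (k : ℂ) ^ 2 * inner ℂ (J v) (J u) := by
    intro u v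
    change inner ℂ v (G'.adjoint (G u) - (k : ℂ) ^ 2 • J'.adjoint (J u)) = _
    rw [inner_sub_right, inner_smul_right, ContinuousLinearMap.adjoint_inner_right,
      ContinuousLinearMap.adjoint_inner_right]
    rfl
  have hc : 0 < (1 - P * k ^ 2) / (1 + P) := div_pos (by linarith) (by linarith)
  have hunit : IsUnit S := by
    refine ContinuousLinearMap.isUnit_of_forall_le_norm_inner_map S
      (c := ⟨_, hc.le⟩) hc fun u => ?_
    have h1 : inner ℂ u (S u) = ((‖G u‖ ^ 2 - k ^ 2 * ‖J u‖ ^ 2 : ℝ) : ℂ) := by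
      rw [hS, inner_self_eq_norm_sq_to_K, inner_self_eq_norm_sq_to_K]
      push_cast
      rfl
    rw [norm_inner_symm, h1, Complex.norm_real]
    refine le_trans ?_ (le_abs_self _)
    change ‖u‖ ^ 2 * ((1 - P * k ^ 2) / (1 + P)) ≤ _
    have h2 := mul_le_mul_of_nonneg_left (hpoin u) (sq_nonneg k)
    have h3 : ‖u‖ ^ 2 ≤ (1 + P) * ‖G u‖ ^ 2 := by linarith [hnorm u, hpoin u]
    calc ‖u‖ ^ 2 * ((1 - P * k ^ 2) / (1 + P))
        ≤ ((1 + P) * ‖G u‖ ^ 2) * ((1 - P * k ^ 2) / (1 + P)) :=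
          mul_le_mul_of_nonneg_right h3 hc.le
      _ = (1 - P * k ^ 2) * ‖G u‖ ^ 2 := by
          have : (1 + P) ≠ 0 := by linarith
          field_simp
      _ ≤ ‖G u‖ ^ 2 - k ^ 2 * ‖J u‖ ^ 2 := by linarith
  have hbij : Function.Bijective S := ContinuousLinearMap.isUnit_iff_bijective.1 hunit
  have hiff : ∀ u, (∀ v, inner ℂ (G v) (G u) - (k : ℂ) ^ 2 * inner ℂ (J v) (J u)
      = inner ℂ (J v) g) ↔ S u = J'.adjoint g := by
    intro u
    have hadj : ∀ v, inner ℂ (J v) g = inner ℂ v (J'.adjoint g) := fun v =>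
      (ContinuousLinearMap.adjoint_inner_right J' v g).symm
    simp_rw [← hS, hadj]
    exact ⟨fun h => ext_inner_left ℂ h, fun h v => by rw [h]⟩
  simp_rw [hiff]
  exact hbij.existsUnique _

/-- A priori bound, by testing the equation with its solution. The factor `2` is not sharp: the
argument also gives `√(1 + P k²)` in its place. -/
theorem sqrt_energy_le_of_poincare (G : V →ₗ[ℂ] E) (J : V →ₗ[ℂ] F) {P k s : ℝ} (hP : 0 ≤ P)
    (hpoin : ∀ v, ‖J v‖ ^ 2 ≤ P * ‖G v‖ ^ 2) (hPs : P * k ^ 2 ≤ s) (hs : s < 1) {g : F} {u : V}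
    (hu : inner ℂ (G u) (G u) - (k : ℂ) ^ 2 * inner ℂ (J u) (J u) = inner ℂ (J u) g) :
    √(‖G u‖ ^ 2 + k ^ 2 * ‖J u‖ ^ 2) ≤ 2 * (1 - s)⁻¹ * √P * ‖g‖ := by
  have hJ : ‖J u‖ ≤ √P * ‖G u‖ := by
    refine abs_le_of_sq_le_sq' ?_ (by positivity) |>.2
    rw [mul_pow, Real.sq_sqrt hP]
    exact hpoin u
  have h1 : ‖G u‖ ^ 2 - k ^ 2 * ‖J u‖ ^ 2 ≤ ‖J u‖ * ‖g‖ := by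
    have h : ((‖G u‖ ^ 2 - k ^ 2 * ‖J u‖ ^ 2 : ℝ) : ℂ) = inner ℂ (J u) g := by
      rw [← hu, inner_self_eq_norm_sq_to_K, inner_self_eq_norm_sq_to_K]
      push_cast
      rfl
    refine le_trans (le_abs_self _) ?_
    rw [← Real.norm_eq_abs, ← Complex.norm_real, h]
    exact norm_inner_le_norm _ _
  have h2 : k ^ 2 * ‖J u‖ ^ 2 ≤ s * ‖G u‖ ^ 2 := by
    have h := mul_le_mul_of_nonneg_left (hpoin u) (sq_nonneg k)
    have h' := mul_le_mul_of_nonneg_right hPs (sq_nonneg ‖G u‖)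
    linarith
  have hG : ‖G u‖ ≤ (1 - s)⁻¹ * (√P * ‖g‖) := by
    rw [inv_mul_eq_div, le_div_iff₀ (by linarith)]
    rcases (norm_nonneg (G u)).eq_or_lt with h0 | h0
    · rw [← h0, zero_mul]
      positivity
    · refine le_of_mul_le_mul_right ?_ h0
      have := mul_le_mul_of_nonneg_right hJ (norm_nonneg g)
      nlinarith
  calc √(‖G u‖ ^ 2 + k ^ 2 * ‖J u‖ ^ 2) ≤ 2 * ‖G u‖ := by
        refine Real.sqrt_le_iff.2 ⟨by positivity, ?_⟩
        nlinarith [sq_nonneg ‖G u‖]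
    _ ≤ 2 * ((1 - s)⁻¹ * (√P * ‖g‖)) := by linarith
    _ = 2 * (1 - s)⁻¹ * √P * ‖g‖ := by ring

end Abstract

/-! ### Completeness of the Sobolev spaces -/

section Sobolev

variable {d : ℕ} {D : Set (Pt d)}

/-- Integration of a coordinate against a test function is an inner product in `L²`. -/
lemma integral_smul_coord_eq_inner {ψ : Pt d → ℝ} (hψ : Continuous ψ) (hc : HasCompactSupport ψ)
    (j : Fin d) :
    ∃ Ψ : Lp (EuclideanSpace ℂ (Fin d)) 2 (volume.restrict D),
      ∀ g : Lp (EuclideanSpace ℂ (Fin d)) 2 (volume.restrict D),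
        ∫ x in D, ψ x • (g x) j = inner ℂ Ψ g := by
  have h : MemLp (fun x => ψ x • EuclideanSpace.single j (1 : ℂ)) 2 (volume.restrict D) :=
    ((hψ.smul continuous_const).memLp_of_hasCompactSupport hc.smul_right).restrict D
  refine ⟨h.toLp _, fun g => ?_⟩
  rw [L2.inner_def]
  refine integral_congr_ae ?_
  filter_upwards [h.coeFn_toLp] with x hx
  rw [hx, inner_smul_left_eq_smul, EuclideanSpace.inner_single_left, map_one, one_mul]

/-- Integration against a test function is an inner product in `L²`. -/
lemma integral_smul_eq_inner {ψ : Pt d → ℝ} (hψ : Continuous ψ) (hc : HasCompactSupport ψ) :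
    ∃ Ψ : Lp ℂ 2 (volume.restrict D), ∀ u : Lp ℂ 2 (volume.restrict D),
      ∫ x in D, ψ x • u x = inner ℂ Ψ u := by
  have h : MemLp (fun x => ψ x • (1 : ℂ)) 2 (volume.restrict D) :=
    ((hψ.smul continuous_const).memLp_of_hasCompactSupport hc.smul_right).restrict D
  refine ⟨h.toLp _, fun u => ?_⟩
  rw [L2.inner_def]
  refine integral_congr_ae ?_
  filter_upwards [h.coeFn_toLp] with x hx
  rw [hx]
  simp [mul_comm]

lemma isClosed_H1 : IsClosed (H1 D : Set (L2Pair D)) := by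
  have key : ∀ φ : Pt d → ℝ, ContDiff ℝ ∞ φ → HasCompactSupport φ → ∀ j : Fin d,
      IsClosed {p : L2Pair D |
        ∫ x in D, (fderiv ℝ φ x (EuclideanSpace.single j 1)) • p.fst x
          = - ∫ x in D, φ x • (p.snd x) j} := by
    intro φ hφ hc j
    obtain ⟨Φ, hΦ⟩ := integral_smul_eq_inner (D := D)
      (ψ := fun x => fderiv ℝ φ x (EuclideanSpace.single j 1))
      ((hφ.continuous_fderiv (by simp)).clm_apply continuous_const)
      (hc.fderiv_apply (𝕜 := ℝ) (EuclideanSpace.single j 1))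
    obtain ⟨Ψ, hΨ⟩ := integral_smul_coord_eq_inner (D := D) hφ.continuous hc j
    simp_rw [hΦ, hΨ]
    exact isClosed_eq (continuous_const.inner (WithLp.continuous_fst _ _ _))
      (continuous_const.inner (WithLp.continuous_snd _ _ _)).neg
  have : (H1 D : Set (L2Pair D)) = ⋂ (φ : Pt d → ℝ) (_ : ContDiff ℝ ∞ φ)
      (_ : HasCompactSupport φ) (_ : tsupport φ ⊆ D) (j : Fin d), {p : L2Pair D |
        ∫ x in D, (fderiv ℝ φ x (EuclideanSpace.single j 1)) • p.fst x
          = - ∫ x in D, φ x • (p.snd x) j} := by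
    ext p
    simp only [Set.mem_iInter]
    rfl
  rw [this]
  exact isClosed_iInter fun φ => isClosed_iInter fun hφ => isClosed_iInter fun hc =>
    isClosed_iInter fun _ => isClosed_iInter fun j => key φ hφ hc j

instance completeSpace_H1 : CompleteSpace (H1 D) := isClosed_H1.completeSpace_coe

instance completeSpace_H1Zero (Γ : Set (Pt d)) : CompleteSpace (H1Zero D Γ) :=
  (Submodule.isClosed_topologicalClosure _).completeSpace_coe

/-- The embedding `H¹_Γ(D) → L²(D)`. -/
def fnL (D Γ : Set (Pt d)) : H1Zero D Γ →ₗ[ℂ] Lp ℂ 2 (volume.restrict D) where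
  toFun v := fn v.1
  map_add' _ _ := rfl
  map_smul' _ _ := rfl

/-- The weak gradient as a linear map `H¹_Γ(D) → L²(D; ℂ^d)`. -/
def gradL (D Γ : Set (Pt d)) :
    H1Zero D Γ →ₗ[ℂ] Lp (EuclideanSpace ℂ (Fin d)) 2 (volume.restrict D) where
  toFun v := grad v.1
  map_add' _ _ := rfl
  map_smul' _ _ := rfl

lemma fnL_apply {Γ : Set (Pt d)} (v : H1Zero D Γ) : fnL D Γ v = fn v.1 := rfl

lemma gradL_apply {Γ : Set (Pt d)} (v : H1Zero D Γ) : gradL D Γ v = grad v.1 := rfl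

lemma norm_sq_H1Zero (D Γ : Set (Pt d)) (v : H1Zero D Γ) :
    ‖v‖ ^ 2 = ‖gradL D Γ v‖ ^ 2 + ‖fnL D Γ v‖ ^ 2 := by
  rw [add_comm]
  exact WithLp.prod_norm_sq_eq_of_L2 v.1.1

lemma helmholtzForm_eq_inner {Γ : Set (Pt d)} (k : ℝ) (u v : H1Zero D Γ) :
    helmholtzForm k u.1 v.1 = inner ℂ (gradL D Γ v) (gradL D Γ u)
      - (k : ℂ) ^ 2 * inner ℂ (fnL D Γ v) (fnL D Γ u) := by
  simp only [fnL_apply, gradL_apply, L2.inner_def, RCLike.inner_apply]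
  rfl

lemma integral_mul_conj_eq_inner {Γ : Set (Pt d)} {g : Pt d → ℂ}
    (hg : MemLp g 2 (volume.restrict D)) (v : H1Zero D Γ) :
    ∫ x in D, g x * starRingEnd ℂ (fn v.1 x) = inner ℂ (fnL D Γ v) (hg.toLp g) := by
  rw [L2.inner_def]
  refine integral_congr_ae ?_
  filter_upwards [hg.coeFn_toLp] with x hx
  rw [hx]
  rfl

lemma weakEquation_iff_inner {Γ : Set (Pt d)} {g : Pt d → ℂ}
    (hg : MemLp g 2 (volume.restrict D)) (k : ℝ) (u : H1Zero D Γ) :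
    (∀ v : H1Zero D Γ, helmholtzForm k u.1 v.1 = ∫ x in D, g x * starRingEnd ℂ (fn v.1 x)) ↔
      ∀ v, inner ℂ (gradL D Γ v) (gradL D Γ u) - (k : ℂ) ^ 2 * inner ℂ (fnL D Γ v) (fnL D Γ u)
        = inner ℂ (fnL D Γ v) (hg.toLp g) := by
  simp_rw [helmholtzForm_eq_inner, integral_mul_conj_eq_inner hg]

lemma helmholtzForm_conj (k : ℝ) (u v : H1 D) :
    starRingEnd ℂ (helmholtzForm k u v) = helmholtzForm k v u := by
  unfold helmholtzForm
  simp only [map_sub, map_mul, map_pow, Complex.conj_ofReal, ← integral_conj, inner_conj_symm,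
    Complex.conj_conj]
  congr! 4 with x
  exact mul_comm _ _

/-- Well-posedness of the mixed boundary value problem for `-(Δ + k²) u = g` in a space `H¹_Γ(D)`
in which a Poincaré inequality with constant `P < k⁻²` holds. -/
theorem weakProblem_wellPosed {Γ : Set (Pt d)} {P k s : ℝ} (hP : 0 ≤ P)
    (hpoin : ∀ v : H1Zero D Γ, ‖fn v.1‖ ^ 2 ≤ P * ‖grad v.1‖ ^ 2) (hPs : P * k ^ 2 ≤ s)
    (hs : s < 1) {g : Pt d → ℂ} (hg : MemLp g 2 (volume.restrict D)) :
    (∃! u : H1Zero D Γ, ∀ v : H1Zero D Γ,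
      helmholtzForm k u.1 v.1 = ∫ x in D, g x * starRingEnd ℂ (fn v.1 x)) ∧
    ∀ u : H1Zero D Γ, (∀ v : H1Zero D Γ,
      helmholtzForm k u.1 v.1 = ∫ x in D, g x * starRingEnd ℂ (fn v.1 x)) →
        energyNorm k u.1 ≤ 2 * (1 - s)⁻¹ * √P * l2Norm D g := by
  have hpoin' : ∀ v : H1Zero D Γ, ‖fnL D Γ v‖ ^ 2 ≤ P * ‖gradL D Γ v‖ ^ 2 := hpoin
  have hiff := weakEquation_iff_inner (Γ := Γ) hg k
  constructor
  -- Fixing the spaces before the maps spares an expensive unification of instances on `H¹_Γ(D)`.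
  · have h := existsUnique_of_poincare (V := H1Zero D Γ)
      (E := Lp (EuclideanSpace ℂ (Fin d)) 2 (volume.restrict D)) (F := Lp ℂ 2 (volume.restrict D))
    have h := @h (gradL D Γ) (fnL D Γ) P k hP (norm_sq_H1Zero D Γ) hpoin' (hPs.trans_lt hs)
      (hg.toLp g)
    exact (existsUnique_congr hiff).2 h
  · intro u hu
    have h := sqrt_energy_le_of_poincare (V := H1Zero D Γ)
      (E := Lp (EuclideanSpace ℂ (Fin d)) 2 (volume.restrict D)) (F := Lp ℂ 2 (volume.restrict D))
    have h := @h (gradL D Γ) (fnL D Γ) P k s hP hpoin' hPs hs (hg.toLp g) u ((hiff u).1 hu u)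
    have hnorm : ‖hg.toLp g‖ = l2Norm D g := Lp.norm_toLp g hg
    exact hnorm ▸ h

end Sobolev

/-! ### The Poincaré constant and the mesh size -/

section Constants

variable {d : ℕ} {G : Geometry d} {T : CoarseMesh G.Ω} {k : ℝ}

/-- The mesh size is positive: the element that has `O_i` as a vertex is nonempty and open in a
space of positive dimension. -/
lemma size_pos (hd : 2 ≤ d) (i : Fin T.N) : 0 < T.size := by
  obtain ⟨j, -⟩ : ∃ j, T.node i ∈ (T.vert j : Set (Pt d)) :=
    Set.mem_iUnion.1 (T.range_node ▸ Set.mem_range_self i)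
  have : Nonempty (Fin d) := ⟨⟨0, by omega⟩⟩
  have hb : Bornology.IsBounded (T.elem j) := G.isBounded.subset (T.elem_subset j)
  have hnt : (T.elem j).Nontrivial := by
    obtain ⟨x, hx⟩ := (T.elem_connected j).nonempty
    exact (infinite_of_mem_nhds x ((T.elem_open j).mem_nhds hx)).nontrivial
  exact (Metric.diam_pos hnt hb).trans_le
    (le_ciSup (f := fun j => Metric.diam (T.elem j)) (Set.finite_range _).bddAbove j)

/-- The largest Poincaré constant is finite and satisfies the resolution condition in squared
form. Finiteness uses `H > 0`, as `∞ * 0 = 0` in `ℝ≥0∞`. -/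
lemma iSup_Cpoin_lt (hk : 0 < k) (hres : ScaleResolution G T k) (i : Fin T.N) (hH : 0 < T.size) :
    (⨆ j, Cpoin G T j) ≠ ⊤ ∧ (⨆ j, Cpoin G T j).toReal * (T.size * k) ^ 2 < 1 := by
  have : Nonempty (Fin T.N) := ⟨i⟩
  obtain ⟨j, hj⟩ := exists_eq_ciSup_of_finite (f := fun j => Cpoin G T j)
  rw [← hj]
  have hHk : 0 < T.size * k := mul_pos hH hk
  have h1 : Cpoin G T j ^ (1 / 2 : ℝ) * ENNReal.ofReal (T.size * k) < 1 :=
    (mul_le_mul_left (le_iSup (fun i => Cpoin G T i ^ (1 / 2 : ℝ)) j) _).trans_lt hres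
  have htop : Cpoin G T j ≠ ⊤ := by
    intro h
    rw [h, ENNReal.top_rpow_of_pos (by norm_num),
      ENNReal.top_mul (ENNReal.ofReal_pos.2 hHk).ne'] at h1
    exact not_top_lt h1
  refine ⟨htop, ?_⟩
  have h2 := (ENNReal.toReal_lt_toReal h1.ne_top ENNReal.one_ne_top).2 h1
  rw [ENNReal.toReal_mul, ENNReal.toReal_ofReal hHk.le, ← ENNReal.toReal_rpow,
    ← Real.sqrt_eq_rpow, ENNReal.toReal_one] at h2
  have h3 := pow_lt_one₀ (by positivity) h2 two_ne_zero
  rwa [mul_pow, Real.sq_sqrt ENNReal.toReal_nonneg] at h3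

lemma norm_fn_sq_le (i : Fin T.N) (hH : 0 < T.size) (hC : Cpoin G T i ≠ ⊤)
    (v : LocSpace G T i) :
    ‖fn v.1‖ ^ 2 ≤ (Cpoin G T i).toReal * T.size ^ 2 * ‖grad v.1‖ ^ 2 := by
  have hH0 : ENNReal.ofReal T.size ^ 2 ≠ 0 := pow_ne_zero _ (ENNReal.ofReal_pos.2 hH).ne'
  have hH1 : ENNReal.ofReal T.size ^ 2 ≠ ⊤ := ENNReal.pow_ne_top ENNReal.ofReal_ne_top
  have h1 : ‖fn v.1‖ₑ ^ 2 / ‖grad v.1‖ₑ ^ 2 ≤ Cpoin G T i * ENNReal.ofReal T.size ^ 2 := by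
    rw [Cpoin, ENNReal.div_mul_cancel hH0 hH1]
    exact le_iSup (fun w : LocSpace G T i => ‖fn w.1‖ₑ ^ 2 / ‖grad w.1‖ₑ ^ 2) v
  have hfin : Cpoin G T i * ENNReal.ofReal T.size ^ 2 ≠ ⊤ := ENNReal.mul_ne_top hC hH1
  have hg : ‖grad v.1‖ₑ ^ 2 ≠ ⊤ := ENNReal.pow_ne_top enorm_ne_top
  have h2 : ‖fn v.1‖ₑ ^ 2 ≤ Cpoin G T i * ENNReal.ofReal T.size ^ 2 * ‖grad v.1‖ₑ ^ 2 := by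
    -- As `C_poin` is finite, the quotient is not `∞`, and `∇v = 0` forces `v = 0`.
    exact (ENNReal.div_le_iff_le_mul (Or.inr hfin) (Or.inl hg)).1 h1
  have h3 := ENNReal.toReal_mono (ENNReal.mul_ne_top hfin hg) h2
  simpa [ENNReal.toReal_mul, ENNReal.toReal_pow, ENNReal.toReal_ofReal hH.le] using h3

end Constants

/-! ### Subtracting the mean -/

lemma eLpNorm_sub_average_le {α : Type*} [MeasurableSpace α] {μ : Measure α} [IsFiniteMeasure μ]
    {f : α → ℂ} (hf : MemLp f 2 μ) :
    eLpNorm (fun x => f x - ⨍ y, f y ∂μ) 2 μ ≤ eLpNorm f 2 μ := by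
  set m : ℂ := ⨍ y, f y ∂μ with hm
  have hc : MemLp (fun _ : α => m) 2 μ := memLp_const m
  have hs : MemLp (fun x => f x - m) 2 μ := hf.sub hc
  have horth : inner ℂ (hs.toLp _) (hc.toLp _) = 0 := by
    rw [← inner_conj_symm, L2.inner_def]
    have : ∫ x, inner ℂ (hc.toLp _ x) (hs.toLp _ x) ∂μ
        = ∫ x, (f x - m) * starRingEnd ℂ m ∂μ := by
      refine integral_congr_ae ?_
      filter_upwards [hc.coeFn_toLp, hs.coeFn_toLp] with x h1 h2
      rw [h1, h2]
      rfl
    rw [this, integral_mul_const, integral_sub_average, zero_mul, map_zero]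
  have hsum : hf.toLp f = hs.toLp _ + hc.toLp _ := by
    rw [← MemLp.toLp_add]
    congr 1
    ext x
    simp
  have h := norm_add_sq_eq_norm_sq_add_norm_sq_of_inner_eq_zero _ _ horth
  have hle : ‖hs.toLp _‖ ≤ ‖hf.toLp f‖ := by
    refine abs_le_of_sq_le_sq' ?_ (norm_nonneg _) |>.2
    rw [hsum]
    nlinarith [mul_self_nonneg ‖hc.toLp _‖]
  rw [Lp.norm_toLp, Lp.norm_toLp] at hle
  exact (ENNReal.toReal_le_toReal hs.eLpNorm_ne_top hf.eLpNorm_ne_top).1 hle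

section Mean

variable {d : ℕ} {G : Geometry d} {T : CoarseMesh G.Ω} {i : Fin T.N} {A : Set (Pt d)}
  {f : Pt d → ℂ}

lemma volume_locDom_lt_top : volume (locDom G T i) < ⊤ :=
  (G.isBounded.subset fun _ hx => (interior_subset hx.2).1).measure_lt_top

lemma memLp_sub_const (hf : MemLp f 2 (volume.restrict G.dom)) (m : ℂ) :
    MemLp (fun x => f x - m) 2 (volume.restrict (locDom G T i)) := by
  have : IsFiniteMeasure (volume.restrict (locDom G T i)) :=
    isFiniteMeasure_restrict.2 volume_locDom_lt_top.ne
  have hfD : MemLp f 2 (volume.restrict (locDom G T i)) :=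
    hf.mono_measure (Measure.restrict_mono Set.inter_subset_left le_rfl)
  exact hfD.sub (memLp_const m)

/-- Subtracting the mean does not increase the norm on the local domain. If the mean is taken over the
larger set `ω_i`, the estimate passes through `L²(ω_i)`, where `f` is extended by zero. -/
lemma l2Norm_sub_meanOver_le (hA : A = T.nbhd i ∨ A = locDom G T i)
    (hf : MemLp f 2 (volume.restrict G.dom)) :
    l2Norm (locDom G T i) (fun x => f x - meanOver G A f) ≤ l2Norm (locDom G T i) f := by
  have hdom : MeasurableSet G.dom := G.isOpen_perforated.measurableSet
  have hloc : MeasurableSet (locDom G T i) := hdom.inter isOpen_interior.measurableSet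
  have hAD : G.dom ∩ A = locDom G T i := by
    rcases hA with rfl | rfl
    · rfl
    · exact Set.inter_eq_right.2 Set.inter_subset_left
  have hAΩ : A ⊆ G.Ω := by
    have h : T.nbhd i ⊆ G.Ω := fun _ hx => (interior_subset hx).1
    rcases hA with rfl | rfl
    · exact h
    · exact Set.inter_subset_right.trans h
  have : IsFiniteMeasure (volume.restrict A) :=
    isFiniteMeasure_restrict.2 (G.isBounded.subset hAΩ).measure_lt_top.ne
  have hf0 : MemLp (G.dom.indicator f) 2 (volume.restrict A) :=
    ((memLp_indicator_iff_restrict hdom).2 hf).restrict A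
  have hfD : MemLp f 2 (volume.restrict (locDom G T i)) :=
    hf.mono_measure (Measure.restrict_mono Set.inter_subset_left le_rfl)
  refine ENNReal.toReal_mono hfD.eLpNorm_ne_top ?_
  calc eLpNorm (fun x => f x - meanOver G A f) 2 (volume.restrict (locDom G T i))
      = eLpNorm (fun x => G.dom.indicator f x - meanOver G A f) 2
          (volume.restrict (locDom G T i)) := by
        refine eLpNorm_congr_ae ?_
        filter_upwards [ae_restrict_mem hloc] with x hx
        rw [Set.indicator_of_mem hx.1]
    _ ≤ eLpNorm (fun x => G.dom.indicator f x - meanOver G A f) 2 (volume.restrict A) :=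
        eLpNorm_mono_measure _
          (Measure.restrict_mono (hAD ▸ Set.inter_subset_right) le_rfl)
    _ ≤ eLpNorm (G.dom.indicator f) 2 (volume.restrict A) := eLpNorm_sub_average_le hf0
    _ = eLpNorm f 2 (volume.restrict (locDom G T i)) := by
        rw [eLpNorm_indicator_eq_eLpNorm_restrict hdom, Measure.restrict_restrict hdom, hAD]

end Mean

/-! ### The local problems -/

section LocalProblem

variable {d : ℕ} {G : Geometry d} {T : CoarseMesh G.Ω} {k : ℝ} {i : Fin T.N}

/-- The form is Hermitian, so conjugating the dual equation gives the primal one. -/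
lemma isDualLocalSolution_iff {w : Pt d → ℂ} {m : ℂ} {z : LocSpace G T i} :
    IsDualLocalSolution G T i k w m z ↔ IsLocalSolution G T i k w m z := by
  refine forall_congr' fun v => ?_
  rw [← (starRingEnd ℂ).injective.eq_iff, helmholtzForm_conj, ← integral_conj]
  simp_rw [map_mul, Complex.conj_conj, mul_comm]

theorem localProblem_wellPosed (hd : 2 ≤ d) (hk : 0 < k) (hres : ScaleResolution G T k)
    {A : Set (Pt d)} (hA : A = T.nbhd i ∨ A = locDom G T i) {f : Pt d → ℂ}
    (hf : MemLp f 2 (volume.restrict G.dom)) :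
    (∃! u, IsLocalSolution G T i k f (meanOver G A f) u) ∧
      ∀ u, IsLocalSolution G T i k f (meanOver G A f) u →
        energyNorm k u.1 ≤ 2 * Ce G T k * √(Cpoin G T i).toReal * T.size *
          l2Norm (locDom G T i) f := by
  have hH : 0 < T.size := size_pos hd i
  obtain ⟨htop, hlt⟩ := iSup_Cpoin_lt hk hres i hH
  have hle : Cpoin G T i ≤ ⨆ j, Cpoin G T j := le_iSup (fun j => Cpoin G T j) i
  have hpoin := norm_fn_sq_le i hH (ne_top_of_le_ne_top htop hle)
  have hP : 0 ≤ (Cpoin G T i).toReal * T.size ^ 2 := by positivity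
  have hPs : (Cpoin G T i).toReal * T.size ^ 2 * k ^ 2
      ≤ (⨆ j, Cpoin G T j).toReal * (T.size * k) ^ 2 := by
    rw [mul_assoc, ← mul_pow]
    exact mul_le_mul_of_nonneg_right (ENNReal.toReal_mono htop hle) (sq_nonneg _)
  have hg := memLp_sub_const (T := T) (i := i) hf (meanOver G A f)
  obtain ⟨hex, hest⟩ := weakProblem_wellPosed (D := locDom G T i) (Γ := dirichletPart G T i)
    hP hpoin hPs hlt hg
  refine ⟨hex, fun u hu => (hest u hu).trans ?_⟩
  have hCe : 0 < Ce G T k := inv_pos.2 (by linarith)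
  rw [Real.sqrt_mul ENNReal.toReal_nonneg, Real.sqrt_sq hH.le,
    mul_assoc (2 * Ce G T k)]
  exact mul_le_mul_of_nonneg_left (l2Norm_sub_meanOver_le hA hf)
    (mul_nonneg (mul_nonneg zero_le_two hCe.le) (by positivity))

end LocalProblem

end PerforatedHelmholtz

end

theorem mainTheorem6 {d : ℕ} (hd : 2 ≤ d) (G : PerforatedHelmholtz.Geometry d)
    (T : PerforatedHelmholtz.CoarseMesh G.Ω) (k : ℝ) (hk : 0 < k)
    (hres : PerforatedHelmholtz.ScaleResolution G T k) (i : Fin T.N)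
    (A : Set (PerforatedHelmholtz.Pt d))
    (hA : A = T.nbhd i ∨ A = PerforatedHelmholtz.locDom G T i) :
    (∀ f : PerforatedHelmholtz.Pt d → ℂ, MemLp f 2 (volume.restrict G.dom) →
      (∃! u, PerforatedHelmholtz.IsLocalSolution G T i k f
        (PerforatedHelmholtz.meanOver G A f) u) ∧
      ∀ u, PerforatedHelmholtz.IsLocalSolution G T i k f
          (PerforatedHelmholtz.meanOver G A f) u →
        PerforatedHelmholtz.energyNorm k u.1 ≤
          2 * PerforatedHelmholtz.Ce G T k * Real.sqrt (PerforatedHelmholtz.Cpoin G T i).toReal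
            * T.size * PerforatedHelmholtz.l2Norm (PerforatedHelmholtz.locDom G T i) f) ∧
    (∀ w : PerforatedHelmholtz.Pt d → ℂ, MemLp w 2 (volume.restrict G.dom) →
      (∃! z, PerforatedHelmholtz.IsDualLocalSolution G T i k w
        (PerforatedHelmholtz.meanOver G A w) z) ∧
      ∀ z, PerforatedHelmholtz.IsDualLocalSolution G T i k w
          (PerforatedHelmholtz.meanOver G A w) z →
        PerforatedHelmholtz.energyNorm k z.1 ≤
          2 * PerforatedHelmholtz.Ce G T k * Real.sqrt (PerforatedHelmholtz.Cpoin G T i).toReal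
            * T.size * PerforatedHelmholtz.l2Norm (PerforatedHelmholtz.locDom G T i) w) := by
  refine ⟨fun f hf => PerforatedHelmholtz.localProblem_wellPosed hd hk hres hA hf,
    fun w hw => ?_⟩
  simp_rw [PerforatedHelmholtz.isDualLocalSolution_iff]
  exact PerforatedHelmholtz.localProblem_wellPosed hd hk hres hA hw
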